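/- A series $\sum_{n=0}^\infty c_n$ of complex numbers is called $(\mathrm{B}')$ summable to $\beta$ if the power series $f(t)=\sum_{n=0}^\infty (c_n/n!)\,t^n$ converges for every $t$ and $\lim_{\lambda\to\infty}\int_0^\lambda e^{-t}f(t)\,dt=\beta$; a family of such series is uniformly $(\mathrm{B}')$ summable if this limit exists uniformly over the family. Theorem. Let $\sum_{n=0}^\infty a_n z^n$ be a formal power series with complex coefficients. If for some $r>0$ the series $\sum_{n=0}^\infty a_n r^n e^{in\theta}$ is uniformly $(\mathrm{B}')$ summable for $\theta\in[0,2\pi]$, then $\sum_{n=0}^\infty a_n z^n$ has positive radius of convergence $R\ge r$. -/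

import Mathlib

/-- The series `f(t) = ∑ (aₙ / n!) tⁿ` associated with the series `∑ aₙ` by Borel's method. -/
noncomputable def borelSeries (a : ℕ → ℂ) (t : ℂ) : ℂ :=
  ∑' n : ℕ, a n / (n.factorial : ℂ) * t ^ n

/-- The power series `∑ (aₙ / n!) tⁿ` converges for every `t`. -/
def BorelSeriesConverges (a : ℕ → ℂ) : Prop :=
  ∀ t : ℂ, Summable fun n : ℕ => a n / (n.factorial : ℂ) * t ^ n

/-- The truncated Borel integral `∫₀^T e^{-t} f(t) dt`, where `f(t) = ∑ (aₙ / n!) tⁿ`. -/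
noncomputable def borelIntegral (a : ℕ → ℂ) (T : ℝ) : ℂ :=
  ∫ t in (0 : ℝ)..T, Complex.exp (-(t : ℂ)) * borelSeries a (t : ℂ)

/-- The series `∑ aₙ` is summable to `β` by the Borel method `(B')`. -/
def HasBorelSum (a : ℕ → ℂ) (β : ℂ) : Prop :=
  BorelSeriesConverges a ∧ Filter.Tendsto (borelIntegral a) Filter.atTop (nhds β)

/-- The family of series `∑ₙ c x n`, for `x ∈ S`, is uniformly `(B')` summable: every series
`∑ₙ (c x n / n!) tⁿ` converges for all `t`, and the truncated Borel integrals converge, as the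
upper limit of integration tends to infinity, uniformly for `x ∈ S`. -/
def UniformlyBorelSummableOn {ι : Type*} (c : ι → ℕ → ℂ) (S : Set ι) : Prop :=
  (∀ x ∈ S, BorelSeriesConverges (c x)) ∧
    ∃ β : ι → ℂ, TendstoUniformlyOn (fun (T : ℝ) (x : ι) => borelIntegral (c x) T) β
      Filter.atTop S

/-- The radius of convergence, in `[0, ∞]`, of a formal power series `∑ aₙ zⁿ`. -/
noncomputable def radiusOfConvergence (p : PowerSeries ℂ) : ENNReal :=
  (FormalMultilinearSeries.ofScalars ℂ (fun n : ℕ => PowerSeries.coeff n p)).radius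

open Filter Topology

/-! With `b n = aₙ rⁿ` and `γₙ = truncatedGamma n`, the Borel integral up to `T` at angle `θ` is a
Fourier series with coefficients `b n / n! * γₙ(T)` (`borelIntegral_hasSum`). Uniformity gives an
`S` past which these integrals differ by at most 1 for all `θ`, so `norm_coeff_le_of_fourier_bound`
gives `|b n| (γₙ(T) - γₙ(S)) ≤ n!`. As `T → ∞`, `γₙ(T) → n!`, whereas `γₙ(S) ≤ S^(n+1)` is
negligible against `n!`. Hence `b n` is bounded. -/

/-- The incomplete Gamma integral `∫₀^T e^{-t} tⁿ dt`. -/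
noncomputable def truncatedGamma (n : ℕ) (T : ℝ) : ℝ :=
  ∫ t in (0 : ℝ)..T, Real.exp (-t) * t ^ n

theorem truncatedGamma_tendsto (n : ℕ) :
    Tendsto (truncatedGamma n) atTop (𝓝 (n.factorial : ℝ)) := by
  have hpos : (0 : ℝ) < (n : ℝ) + 1 := by positivity
  have hint := Real.GammaIntegral_convergent hpos
  have hval := Real.Gamma_eq_integral hpos
  rw [Real.Gamma_nat_eq_factorial] at hval
  simp only [add_sub_cancel_right, Real.rpow_natCast] at hint hval
  rw [hval]
  exact MeasureTheory.intervalIntegral_tendsto_integral_Ioi 0 hint tendsto_id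

theorem norm_truncatedGamma_le (n : ℕ) {T : ℝ} (hT : 0 ≤ T) :
    ‖truncatedGamma n T‖ ≤ T ^ n * T := by
  have h := intervalIntegral.norm_integral_le_of_norm_le_const (a := 0) (b := T)
    (f := fun t : ℝ => Real.exp (-t) * t ^ n) (C := T ^ n) (fun t ht => by
      rw [Set.uIoc_of_le hT] at ht
      rw [norm_mul, norm_pow, Real.norm_of_nonneg (Real.exp_pos _).le,
        Real.norm_of_nonneg ht.1.le]
      have h1 : Real.exp (-t) ≤ 1 := Real.exp_le_one_iff.2 (by linarith [ht.1])
      calc Real.exp (-t) * t ^ n ≤ 1 * T ^ n :=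
            mul_le_mul h1 (pow_le_pow_left₀ ht.1.le ht.2 n) (pow_nonneg ht.1.le n) zero_le_one
        _ = T ^ n := one_mul _)
  simpa [truncatedGamma, abs_of_nonneg hT] using h

theorem hasSum_of_eq {f g : ℕ → ℂ} {s : ℂ} (hfg : ∀ n, f n = g n) (hg : HasSum g s) :
    HasSum f s := funext hfg ▸ hg

/-- Termwise integration of a series of continuous functions with a summable uniform bound. -/
theorem intervalIntegral_hasSum_of_norm_le {F : ℕ → ℝ → ℂ} {f : ℝ → ℂ} {u : ℕ → ℝ} {a b : ℝ}
    (hF : ∀ n, Continuous (F n)) (hu : Summable u)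
    (hbound : ∀ n, ∀ t ∈ Set.uIoc a b, ‖F n t‖ ≤ u n)
    (hsum : ∀ t ∈ Set.uIoc a b, HasSum (fun n => F n t) (f t)) :
    HasSum (fun n => ∫ t in a..b, F n t) (∫ t in a..b, f t) :=
  intervalIntegral.hasSum_integral_of_dominated_convergence (fun n _ => u n)
    (fun n => (hF n).aestronglyMeasurable) (fun n => .of_forall (hbound n))
    (.of_forall fun _ _ => hu) intervalIntegrable_const (.of_forall hsum)

/-- On `(0, T]` the absolutely convergent series at `t = T` dominates every term, since `e^{-t} ≤
1`. -/
theorem borelIntegral_hasSum {a : ℕ → ℂ} (ha : BorelSeriesConverges a) {T : ℝ} (hT : 0 ≤ T) :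
    HasSum (fun n => a n / (n.factorial : ℂ) * (truncatedGamma n T : ℂ)) (borelIntegral a T) := by
  have key := intervalIntegral_hasSum_of_norm_le (a := 0) (b := T)
    (F := fun n t => Complex.exp (-(t : ℂ)) * (a n / (n.factorial : ℂ) * (t : ℂ) ^ n))
    (f := fun t => Complex.exp (-(t : ℂ)) * borelSeries a (t : ℂ))
    (fun n => by fun_prop) (ha (T : ℂ)).norm
    (fun n t ht => by
      rw [Set.uIoc_of_le hT] at ht
      have h1 : ‖Complex.exp (-(t : ℂ))‖ ≤ 1 := by
        rw [Complex.norm_exp]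
        exact Real.exp_le_one_iff.2 (by simpa using ht.1.le)
      have h2 : ‖(t : ℂ) ^ n‖ ≤ ‖(T : ℂ) ^ n‖ := by
        rw [norm_pow, norm_pow, Complex.norm_real, Complex.norm_real,
          Real.norm_of_nonneg ht.1.le, Real.norm_of_nonneg hT]
        exact pow_le_pow_left₀ ht.1.le ht.2 n
      rw [norm_mul, norm_mul, norm_mul]
      exact (mul_le_of_le_one_left (by positivity) h1).trans (by gcongr))
    (fun t _ => (ha (t : ℂ)).hasSum.mul_left _)
  refine hasSum_of_eq (fun n => ?_) key
  rw [truncatedGamma, ← intervalIntegral.integral_ofReal, ← intervalIntegral.integral_const_mul]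
  refine intervalIntegral.integral_congr fun t _ => ?_
  push_cast
  ring

/-- Cauchy's inequality for the coefficients of an absolutely convergent Fourier series. -/
theorem norm_coeff_le_of_fourier_bound {c : ℕ → ℂ} {H : ℝ → ℂ} {M : ℝ}
    (hc : Summable fun n => ‖c n‖)
    (hH : ∀ θ ∈ Set.Icc 0 (2 * Real.pi),
      HasSum (fun n : ℕ => c n * Complex.exp (Complex.I * n * θ)) (H θ))
    (hM : ∀ θ ∈ Set.Icc 0 (2 * Real.pi), ‖H θ‖ ≤ M) (m : ℕ) : ‖c m‖ ≤ M := by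
  have hpi : (0 : ℝ) ≤ 2 * Real.pi := by positivity
  have hnorm (x : ℤ) (θ : ℝ) : ‖Complex.exp (Complex.I * x * θ)‖ = 1 := by
    rw [Complex.norm_exp]; simp
  have horth (n : ℕ) (hn : n ≠ m) :
      ∫ θ in (0 : ℝ)..2 * Real.pi, Complex.exp (Complex.I * ((n - m : ℤ) : ℂ) * θ) = 0 := by
    have hne : Complex.I * ((n - m : ℤ) : ℂ) ≠ 0 := by
      refine mul_ne_zero Complex.I_ne_zero (Int.cast_ne_zero.2 ?_)
      omega
    rw [integral_exp_mul_complex hne]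
    have : Complex.I * ((n - m : ℤ) : ℂ) * ((2 * Real.pi : ℝ) : ℂ)
        = ((n - m : ℤ) : ℂ) * (2 * Real.pi * Complex.I) := by push_cast; ring
    rw [this, Complex.exp_int_mul_two_pi_mul_I]
    simp
  have key := intervalIntegral_hasSum_of_norm_le (a := 0) (b := 2 * Real.pi)
    (F := fun n θ => c n * Complex.exp (Complex.I * ((n - m : ℤ) : ℂ) * θ))
    (f := fun θ => H θ * Complex.exp (Complex.I * ((-m : ℤ) : ℂ) * θ))
    (fun n => by fun_prop) hc
    (fun n θ _ => by rw [norm_mul, hnorm, mul_one])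
    (fun θ hθ => by
      rw [Set.uIoc_of_le hpi] at hθ
      refine hasSum_of_eq (fun n => ?_) ((hH θ ⟨hθ.1.le, hθ.2⟩).mul_right
        (Complex.exp (Complex.I * ((-m : ℤ) : ℂ) * θ)))
      rw [mul_assoc (c n), ← Complex.exp_add]
      push_cast
      ring_nf)
  -- By orthogonality only the `m`-th term survives integration.
  have hval := key.unique (hasSum_single m fun n hn => by
    rw [intervalIntegral.integral_const_mul, horth n hn, mul_zero])
  have hle := intervalIntegral.norm_integral_le_of_norm_le_const (a := 0) (b := 2 * Real.pi)
    (f := fun θ => H θ * Complex.exp (Complex.I * ((-m : ℤ) : ℂ) * θ)) (C := M) (fun θ hθ => by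
      rw [Set.uIoc_of_le hpi] at hθ
      rw [norm_mul, hnorm, mul_one]
      exact hM θ ⟨hθ.1.le, hθ.2⟩)
  rw [hval] at hle
  simp only [sub_self, Int.cast_zero, mul_zero, zero_mul, Complex.exp_zero, mul_one,
    intervalIntegral.integral_const, sub_zero, norm_smul, Real.norm_of_nonneg hpi,
    abs_of_nonneg hpi] at hle
  nlinarith [Real.pi_pos]

theorem theorem1 (p : PowerSeries ℂ) (r : ℝ) (hr : 0 < r)
    (h : UniformlyBorelSummableOn
      (fun (θ : ℝ) (n : ℕ) =>
        PowerSeries.coeff n p * (r : ℂ) ^ n * Complex.exp (Complex.I * (n : ℂ) * (θ : ℂ)))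
      (Set.Icc 0 (2 * Real.pi))) :
    0 < radiusOfConvergence p ∧ ENNReal.ofReal r ≤ radiusOfConvergence p := by
  suffices hle : ENNReal.ofReal r ≤ radiusOfConvergence p from
    ⟨(ENNReal.ofReal_pos.2 hr).trans_le hle, hle⟩
  obtain ⟨hconv, β, hβ⟩ := h
  -- Two errors of `1 / 2` add up to the bound 1 in `hcoeff`.
  obtain ⟨S, hS⟩ := eventually_atTop.1 ((Metric.tendstoUniformlyOn_iff.1 hβ (1 / 2)
    (by norm_num)).and (eventually_ge_atTop 0))
  have hS0 : 0 ≤ S := (hS S le_rfl).2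
  set b : ℕ → ℂ := fun n => PowerSeries.coeff n p * (r : ℂ) ^ n with hb
  -- This is the case `θ = 0`.
  have hb0 : BorelSeriesConverges b := by
    have := hconv 0 ⟨le_rfl, by positivity⟩
    simpa [BorelSeriesConverges, hb] using this
  have hcoeff (T : ℝ) (hT : S ≤ T) (n : ℕ) :
      ‖b n / (n.factorial : ℂ) * ((truncatedGamma n T - truncatedGamma n S : ℝ) : ℂ)‖ ≤ 1 := by
    have hsum := ((borelIntegral_hasSum hb0 (hS0.trans hT)).sub
      (borelIntegral_hasSum hb0 hS0)).summable.norm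
    refine norm_coeff_le_of_fourier_bound
      (c := fun n => b n / (n.factorial : ℂ) * ((truncatedGamma n T - truncatedGamma n S : ℝ) : ℂ))
      (hsum.congr fun n => by push_cast; rw [mul_sub])
      (fun θ hθ => by
        refine hasSum_of_eq (fun n => ?_) ((borelIntegral_hasSum (hconv θ hθ)
          (hS0.trans hT)).sub (borelIntegral_hasSum (hconv θ hθ) hS0))
        simp only [hb]
        push_cast
        ring) (fun θ hθ => ?_) n
    have h1 := (hS T hT).1 θ hθ
    have h2 := (hS S le_rfl).1 θ hθ
    rw [← dist_eq_norm]
    linarith [dist_triangle_left (borelIntegral (fun n => b n *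
        Complex.exp (Complex.I * (n : ℂ) * (θ : ℂ))) T) (borelIntegral (fun n => b n *
        Complex.exp (Complex.I * (n : ℂ) * (θ : ℂ))) S) (β θ)]
  -- `T → ∞` with `S` and `n` fixed; `S` does not depend on `n`.
  have hlim (n : ℕ) :
      ‖b n / (n.factorial : ℂ) * ((n.factorial - truncatedGamma n S : ℝ) : ℂ)‖ ≤ 1 := by
    refine le_of_tendsto (x := atTop) ?_ ((eventually_ge_atTop S).mono fun T hT => hcoeff T hT n)
    exact (((Complex.continuous_ofReal.tendsto _).comp
      ((truncatedGamma_tendsto n).sub_const _)).const_mul _).norm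
  have hsmall : ∀ᶠ n : ℕ in atTop, S ^ n / (n.factorial : ℝ) * S ≤ 1 / 2 := by
    have := (FloorSemiring.tendsto_pow_div_factorial_atTop S).mul_const S
    rw [zero_mul] at this
    exact this.eventually_le_const (by norm_num)
  -- The bound is 2 because `n! - γₙ(S) ≥ n!/2` for large `n`.
  refine FormalMultilinearSeries.le_radius_of_eventually_le _ 2 ?_
  filter_upwards [hsmall] with n hn
  have hfac : (0 : ℝ) < n.factorial := by positivity
  have hg := (le_abs_self _).trans (norm_truncatedGamma_le n hS0)
  have hhalf : (n.factorial : ℝ) / 2 ≤ n.factorial - truncatedGamma n S := by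
    rw [div_mul_eq_mul_div, div_le_iff₀ hfac] at hn
    linarith
  have h1 := hlim n
  rw [norm_mul, norm_div, Complex.norm_natCast, Complex.norm_real,
    Real.norm_of_nonneg (by linarith), div_mul_eq_mul_div, div_le_iff₀ hfac, one_mul] at h1
  have h2 : ‖b n‖ * (n.factorial / 2) ≤ n.factorial :=
    (mul_le_mul_of_nonneg_left hhalf (norm_nonneg _)).trans h1
  have h3 : ‖b n‖ ≤ 2 := by
    by_contra! hlt
    nlinarith
  rw [FormalMultilinearSeries.ofScalars_norm, Real.coe_toNNReal r hr.le]
  simpa [hb, abs_of_pos hr] using h3
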